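/- Let $(\mathbb X,\mathcal X)$ be a measurable space, $V:\mathbb X\to[1,+\infty)$ a measurable function, $\varepsilon_0>0$, and $\{P_\varepsilon\}_{|\varepsilon|<\varepsilon_0}$ a family of Markov kernels on $(\mathbb X,\mathcal X)$. For $\beta\in[0,1]$ let $\mathcal B_\beta$ be the space of measurable $f:\mathbb X\to\mathbb C$ with $\|f\|_\beta:=\sup_{x}V(x)^{-\beta}|f(x)|<\infty$, and for a linear map $T$ put $\|T\|_{\beta,\beta'}:=\sup\{\|Tf\|_{\beta'}: f\in\mathcal B_\beta,\ \|f\|_\beta\le1\}$ and $\|T\|_\beta:=\|T\|_{\beta,\beta}$. Assume that every $P_\varepsilon$ acts continuously on $\mathcal B_1$, and that the following conditions hold. (i) $P_0$ has a unique invariant probability measure $\pi_0$, $\pi_0(V)<\infty$, and there is $\kappa_1\in(0,1)$ with $\|P_0^n-\pi_0(\cdot)1_{\mathbb X}\|_1=O(\kappa_1^n)$. (ii) There are an integer $N\ge1$, $L\in(0,+\infty)$ and $\delta\in(0,1)$ such that $P_\varepsilon^NV\le\delta^NV+L\,1_{\mathbb X}$ for all $\varepsilon\in(-\varepsilon_0,\varepsilon_0)$.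 (iii) For some $\beta\in(0,1]$, there is $\kappa_\beta\in(0,1)$ with $\|P_0^n-\pi_0(\cdot)1_{\mathbb X}\|_\beta=O(\kappa_\beta^n)$, and $\lim_{\varepsilon\to0}\|P_\varepsilon-P_0\|_{\beta,1}=0$. Then there exist $\varepsilon_1\in(0,\varepsilon_0]$ and $C\in(0,+\infty)$ such that, for every $\varepsilon\in(-\varepsilon_1,\varepsilon_1)$, $P_\varepsilon$ has a unique invariant probability measure $\pi_\varepsilon$, $\pi_\varepsilon(V)<\infty$, and $$\sup_{\|f\|_\beta\le1}\big|\pi_\varepsilon(f)-\pi_0(f)\big|\le C\,\|P_\varepsilon-P_0\|_{\beta,1}.$$ -/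

import Mathlib

open MeasureTheory ProbabilityTheory Filter Topology
open scoped ENNReal

namespace PerturbedMarkov

noncomputable section

variable {X : Type*} [MeasurableSpace X]

/-- The weighted supremum norm `‖f‖_β = sup_x V(x)^(-β) |f(x)|`, with values in `[0, ∞]`. -/
def wnorm (V : X → ℝ) (β : ℝ) (f : X → ℂ) : ℝ≥0∞ :=
  ⨆ x : X, ENNReal.ofReal (V x ^ (-β) * ‖f x‖)

/-- The space `B_β` of the measurable functions `f : X → ℂ` with `‖f‖_β < ∞`. -/
def weightedSpace (V : X → ℝ) (β : ℝ) : Set (X → ℂ) :=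
  {f | Measurable f ∧ wnorm V β f < ∞}

/-- The operator norm `‖T‖_{β,β'} = sup {‖T f‖_{β'} : f ∈ B_β, ‖f‖_β ≤ 1}`, in `[0, ∞]`. -/
def opNorm (V : X → ℝ) (β β' : ℝ) (T : (X → ℂ) → (X → ℂ)) : ℝ≥0∞ :=
  ⨆ f ∈ {f : X → ℂ | f ∈ weightedSpace V β ∧ wnorm V β f ≤ 1}, wnorm V β' (T f)

/-- The action of a kernel on functions, `(κ f)(x) = ∫ f(y) κ(x, dy)`. -/
def act (κ : Kernel X X) (f : X → ℂ) : X → ℂ :=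
  fun x => ∫ y, f y ∂(κ x)

/-- `κ` acts continuously on `B_β`: every `κ f` with `f ∈ B_β` is given by convergent integrals,
and `f ↦ κ f` is a bounded operator on `B_β`. -/
def ActsContinuously (V : X → ℝ) (β : ℝ) (κ : Kernel X X) : Prop :=
  (∀ f ∈ weightedSpace V β, ∀ x, Integrable f (κ x)) ∧ opNorm V β β (act κ) < ∞

/-- `π` is the unique invariant probability measure of `κ`. -/
def IsUniqueInvariantProb (κ : Kernel X X) (π : Measure X) : Prop :=
  IsProbabilityMeasure π ∧ κ.Invariant π ∧
    ∀ ν : Measure X, IsProbabilityMeasure ν → κ.Invariant ν → ν = π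

/-- `‖κ^n - π(·) 1_X‖_β = O(ρ^n)` for some `ρ ∈ (0, 1)`. -/
def GeomErgodic (V : X → ℝ) (β : ℝ) (κ : Kernel X X) (π : Measure X) : Prop :=
  ∃ ρ : ℝ, 0 < ρ ∧ ρ < 1 ∧ ∃ c : ℝ, 0 < c ∧ ∀ n : ℕ,
    opNorm V β β (fun f x => act (κ ^ n) f x - ∫ y, f y ∂π) ≤ ENNReal.ofReal (c * ρ ^ n)

/-- The drift inequality `P_ε^N V ≤ δ^N V + L` for all `|ε| < ε₀`, with `N ≥ 1`, `L ∈ (0, ∞)` and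
`δ ∈ (0, 1)` that do not depend on `ε`. -/
def DriftCondition (V : X → ℝ) (ε₀ : ℝ) (P : ℝ → Kernel X X) : Prop :=
  ∃ N : ℕ, 1 ≤ N ∧ ∃ L : ℝ, 0 < L ∧ ∃ δ : ℝ, 0 < δ ∧ δ < 1 ∧
    ∀ ε : ℝ, |ε| < ε₀ → ∀ x : X,
      ∫⁻ y, ENNReal.ofReal (V y) ∂((P ε ^ N) x) ≤ ENNReal.ofReal (δ ^ N * V x + L)

/-- `‖κ - η‖_{β,β'}` for two kernels. -/
def kernelDist (V : X → ℝ) (β β' : ℝ) (κ η : Kernel X X) : ℝ≥0∞ :=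
  opNorm V β β' (fun f x => act κ f x - act η f x)

/-- `sup {|μ(f) - ν(f)| : f ∈ B_β, ‖f‖_β ≤ 1}`. -/
def measureDist (V : X → ℝ) (β : ℝ) (μ ν : Measure X) : ℝ≥0∞ :=
  ⨆ f ∈ {f : X → ℂ | f ∈ weightedSpace V β ∧ wnorm V β f ≤ 1},
    ‖(∫ x, f x ∂μ) - ∫ x, f x ∂ν‖ₑ

end

end PerturbedMarkov

/-! Write `P₀`, `P` for the unperturbed and perturbed kernels and η for the (β,1)-distance between
them. Geometric ergodicity on `B_β` solves the Poisson equation g - P₀g = f - π₀(f) with ‖g‖_β ≤ C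
uniformly over the unit ball (`GeomErgodic.exists_poisson`). If π is P-invariant, integrating
against π gives π(f) - π₀(f) = π(Pg - P₀g), which is at most r = Cη·L/(1-δ^N) because the drift
bounds π(V) by L/(1-δ^N). This is the stated estimate.

The same identity, with a vanishing defect, controls the Cesàro averages of P from a point:
asymptotically they dominate π₀ up to r. Their limit along an ultrafilter is only finitely additive,
but the largest measure below it is invariant, and it is nonzero once r < 1
(`exists_invariant_of_asymptotically_invariant`). Uniqueness comes from 2r < 1: two distinct
invariant probabilities would yield two mutually singular ones, both within r of π₀
(`invariant_unique_of_close`). -/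

namespace PerturbedMarkov

/-! ### Existence: countably additive part of a finitely additive limit -/

/-- If a measure is dominated on measurable sets by the limit of a net of measures along a filter,
then its integrals are dominated by the limits of the integrals. -/
lemma lintegral_le_of_le_of_tendsto {X ι : Type*} [MeasurableSpace X] {u : Filter ι} [u.NeBot]
    {m : ι → Measure X} {ν : Measure X} {l : Set X → ℝ≥0∞}
    (hl : ∀ A, Tendsto (fun i => m i A) u (𝓝 (l A))) (hν : ∀ A, MeasurableSet A → ν A ≤ l A)
    {f : X → ℝ≥0∞} {c : ℝ≥0∞} (hc : Tendsto (fun i => ∫⁻ x, f x ∂(m i)) u (𝓝 c)) :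
    ∫⁻ x, f x ∂ν ≤ c := by
  rw [lintegral_eq_nnreal]
  refine iSup₂_le fun φ hφ => ?_
  set ψ : SimpleFunc X ℝ≥0∞ := SimpleFunc.map ENNReal.ofNNReal φ with hψ
  have hψtop : ∀ y ∈ ψ.range, y ≠ ∞ := by
    intro y hy
    obtain ⟨x, rfl⟩ := SimpleFunc.mem_range.1 hy
    simp [hψ]
  have h1 : Tendsto (fun i => ψ.lintegral (m i)) u
      (𝓝 (∑ y ∈ ψ.range, y * l (ψ ⁻¹' {y}))) := by
    unfold SimpleFunc.lintegral
    exact tendsto_finsetSum _ fun y hy =>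
      ENNReal.Tendsto.const_mul (hl _) (Or.inr (hψtop y hy))
  have h2 : ψ.lintegral ν ≤ ∑ y ∈ ψ.range, y * l (ψ ⁻¹' {y}) := by
    unfold SimpleFunc.lintegral
    gcongr
    exact hν _ (ψ.measurableSet_fiber _)
  refine h2.trans (le_of_tendsto_of_tendsto' h1 hc fun i => ?_)
  rw [← SimpleFunc.lintegral_eq_lintegral]
  exact lintegral_mono fun x => hφ x

/-- Countably additive part of a limit of probability measures: an asymptotically invariant sequence
of probability measures which asymptotically dominates a probability measure up to an error `r < 1`
forces the existence of an invariant probability measure. -/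
theorem exists_invariant_of_asymptotically_invariant {X : Type*} [MeasurableSpace X]
    {κ : Kernel X X} [IsMarkovKernel κ] {m : ℕ → Measure X} [∀ n, IsProbabilityMeasure (m n)]
    {e : ℕ → ℝ≥0∞} (he : Tendsto e atTop (𝓝 0))
    (hm : ∀ n A, MeasurableSet A → (m n).bind κ A ≤ m n A + e n)
    {π₀ : Measure X} [IsProbabilityMeasure π₀] {r : ℝ≥0∞} (hr : r < 1)
    (hπ₀ : ∀ n A, MeasurableSet A → π₀ A ≤ m n A + (r + e n)) :
    ∃ π : Measure X, IsProbabilityMeasure π ∧ κ.Invariant π := by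
  set u : Ultrafilter ℕ := hyperfilter ℕ
  have hu : (u : Filter ℕ) ≤ atTop := by
    rw [← Nat.cofinite_eq_atTop]; exact hyperfilter_le_cofinite
  -- Compactness of [0, ∞] gives a limit on every set, measurable or not; it is finitely additive on
  -- measurable sets.
  set l : Set X → ℝ≥0∞ := fun A => (u.map fun n => m n A).lim with hl_def
  have hl : ∀ A, Tendsto (fun n => m n A) u (𝓝 (l A)) := fun A =>
    Ultrafilter.le_nhds_lim (u.map fun n => m n A)
  have he' := he.mono_left hu
  have hl0 : l ∅ = 0 := tendsto_nhds_unique (hl ∅) (by simp)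
  have hl1 : l Set.univ = 1 := tendsto_nhds_unique (hl Set.univ) (by simp)
  have hcar : ‹MeasurableSpace X› ≤ (OuterMeasure.ofFunction l hl0).caratheodory := by
    intro s hs
    refine OuterMeasure.ofFunction_caratheodory fun t => ?_
    refine le_of_tendsto_of_tendsto' ((hl _).add (hl _)) (hl t) fun n => ?_
    rw [measure_inter_add_sdiff _ hs]
  set ν : Measure X := (OuterMeasure.ofFunction l hl0).toMeasure hcar with hν_def
  have hνl : ∀ A, MeasurableSet A → ν A ≤ l A := fun A hA => by
    rw [hν_def, toMeasure_apply _ _ hA]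
    exact OuterMeasure.ofFunction_le A
  have hνfin : IsFiniteMeasure ν :=
    ⟨(hνl _ MeasurableSet.univ).trans_lt (by rw [hl1]; exact ENNReal.one_lt_top)⟩
  -- maximality among the measures dominated by the limit
  have hmax : ∀ ρ : Measure X, (∀ A, MeasurableSet A → ρ A ≤ l A) → ρ ≤ ν := by
    intro ρ hρ
    have hρ' : ρ.toOuterMeasure ≤ OuterMeasure.ofFunction l hl0 := by
      rw [OuterMeasure.le_ofFunction]
      intro s
      -- One measurable hull serves all the `m n` at once, so passing to it does not change `l`.
      obtain ⟨t, hst, ht, htm⟩ := exists_measurable_superset_forall_eq m s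
      have : l t = l s := by simp only [hl_def, htm]
      calc ρ s ≤ ρ t := measure_mono hst
        _ ≤ l s := this ▸ hρ t ht
    refine Measure.le_iff.2 fun A hA => ?_
    rw [hν_def, toMeasure_apply _ _ hA]
    exact hρ' A
  have hbind : ν.bind κ ≤ ν := by
    refine hmax _ fun A hA => ?_
    rw [Measure.bind_apply hA κ.aemeasurable]
    set c : ℝ≥0∞ := (u.map fun n => ∫⁻ x, κ x A ∂(m n)).lim
    have hc : Tendsto (fun n => ∫⁻ x, κ x A ∂(m n)) u (𝓝 c) :=
      Ultrafilter.le_nhds_lim (u.map fun n => ∫⁻ x, κ x A ∂(m n))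
    refine (lintegral_le_of_le_of_tendsto hl hνl hc).trans ?_
    have h2 : Tendsto (fun n => m n A + e n) u (𝓝 (l A + 0)) := (hl A).add he'
    rw [add_zero] at h2
    refine le_of_tendsto_of_tendsto' hc h2 fun n => ?_
    rw [← Measure.bind_apply hA κ.aemeasurable]
    exact hm n A hA
  have hinv : ν.bind κ = ν := by
    have : IsFiniteMeasure (ν.bind κ) := ⟨(hbind _).trans_lt (measure_lt_top _ _)⟩
    -- A Markov kernel preserves total mass, so the inequality between finite measures is an
    -- equality.
    refine Measure.eq_of_le_of_measure_univ_eq hbind ?_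
    rw [Measure.bind_apply MeasurableSet.univ κ.aemeasurable]
    simp
  -- positivity of the total mass
  have hlπ : ∀ s, π₀ s ≤ l s + r := by
    intro s
    obtain ⟨t, hst, ht, htm⟩ := exists_measurable_superset_forall_eq m s
    have h2 : Tendsto (fun n => m n s + (r + e n)) u (𝓝 (l s + (r + 0))) :=
      (hl s).add (tendsto_const_nhds.add he')
    rw [add_zero] at h2
    refine ge_of_tendsto' h2 fun n => ?_
    rw [← htm n]
    exact (measure_mono hst).trans (hπ₀ n t ht)
  have hlmono : Monotone l := fun s t hst =>
    le_of_tendsto_of_tendsto' (hl s) (hl t) fun n => measure_mono hst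
  have hlacc : ∀ (t : ℕ → Set X) (n : ℕ),
      l (Set.accumulate t n) ≤ ∑ i ∈ Finset.range (n + 1), l (t i) := by
    intro t n
    refine le_of_tendsto_of_tendsto' (hl _) (tendsto_finsetSum _ fun i _ => hl (t i)) fun k => ?_
    refine (measure_mono ?_).trans (measure_biUnion_finset_le (Finset.range (n + 1)) t)
    intro x hx
    obtain ⟨i, hi, hx⟩ := Set.mem_accumulate.1 hx
    exact Set.mem_biUnion (by simpa using Nat.lt_succ_of_le hi) hx
  -- For a countable cover `t`, finite unions exhaust the mass of `π₀` by its countable additivity,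
  -- while `l` of each is at most `∑ l (t i)`; hence 1 ≤ `∑ l (t i)` + `r`.
  have hpos : 1 - r ≤ ν Set.univ := by
    rw [hν_def, toMeasure_apply _ _ MeasurableSet.univ, OuterMeasure.ofFunction_apply]
    refine le_iInf₂ fun t ht => ?_
    rw [tsub_le_iff_right]
    have h1 := tendsto_measure_iUnion_accumulate (μ := π₀) (f := t)
    rw [Set.univ_subset_iff.1 ht, measure_univ] at h1
    refine le_of_tendsto' h1 fun n => (hlπ _).trans ?_
    gcongr
    exact (hlacc t n).trans (ENNReal.sum_le_tsum _)
  have hne : ν Set.univ ≠ 0 := fun h0 => by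
    rw [h0, nonpos_iff_eq_zero, tsub_eq_zero_iff_le] at hpos
    exact absurd hr (not_lt.2 hpos)
  refine ⟨(ν Set.univ)⁻¹ • ν, ⟨?_⟩, ?_⟩
  · rw [Measure.smul_apply, smul_eq_mul, ENNReal.inv_mul_cancel hne (measure_ne_top _ _)]
  · rw [Kernel.Invariant, Measure.bind_smul, hinv]

/-! ### Uniqueness: truncated differences of invariant measures -/

/-- The truncated difference of measures is an admissible remainder. -/
lemma le_sub_add_of_finite {X : Type*} [MeasurableSpace X] (μ ν : Measure X) [IsFiniteMeasure μ]
    [IsFiniteMeasure ν] : μ ≤ (μ - ν) + ν := by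
  obtain ⟨s, hs⟩ := exists_isHahnDecomposition μ ν
  have hsm := hs.measurableSet
  have h : (μ - ν).restrict sᶜ + ν.restrict sᶜ = μ.restrict sᶜ := by
    rw [Measure.restrict_sub_eq_restrict_sub_restrict hsm.compl]
    exact Measure.sub_add_cancel_of_le hs.compl.le_on
  calc μ = μ.restrict s + μ.restrict sᶜ := (Measure.restrict_add_restrict_compl hsm).symm
    _ ≤ ν.restrict s + ((μ - ν).restrict sᶜ + ν.restrict sᶜ) := by
      rw [h]; exact add_le_add_left hs.le_on _
    _ = (μ - ν).restrict sᶜ + (ν.restrict s + ν.restrict sᶜ) := by abel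
    _ = (μ - ν).restrict sᶜ + ν := by rw [Measure.restrict_add_restrict_compl hsm]
    _ ≤ (μ - ν) + ν := add_le_add_left Measure.restrict_le_self _

/-- The truncated difference of two finite invariant measures is invariant. -/
lemma bind_sub_of_invariant {X : Type*} [MeasurableSpace X] {κ : Kernel X X} [IsMarkovKernel κ]
    {μ ν : Measure X} [IsFiniteMeasure μ] [IsFiniteMeasure ν] (hμ : κ.Invariant μ)
    (hν : κ.Invariant ν) : κ.Invariant (μ - ν) := by
  have hfin : IsFiniteMeasure (μ - ν) := ⟨(Measure.sub_le _).trans_lt (measure_lt_top _ _)⟩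
  refine (Measure.eq_of_le_of_measure_univ_eq ?_ ?_).symm
  -- `μ - ν` is the least ρ with μ ≤ ρ + ν, and its image under κ is another such ρ; equal masses
  -- then force equality.
  · refine Measure.sub_le_of_le_add ?_
    calc μ = μ.bind κ := hμ.symm
      _ ≤ ((μ - ν) + ν).bind κ := by
        refine Measure.le_iff.2 fun A hA => ?_
        rw [Measure.bind_apply hA κ.aemeasurable, Measure.bind_apply hA κ.aemeasurable]
        exact lintegral_mono' (le_sub_add_of_finite μ ν) le_rfl
      _ = (μ - ν).bind κ + ν := by rw [Measure.comp_add, hν.def]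
  · rw [Measure.bind_apply MeasurableSet.univ κ.aemeasurable]
    simp

/-- If every invariant probability measure is at distance at most `r < 1 / 2` of a given measure on
measurable sets, then there is at most one invariant probability measure. -/
theorem invariant_unique_of_close {X : Type*} [MeasurableSpace X] {κ : Kernel X X}
    [IsMarkovKernel κ] {π₀ : Measure X} {r : ℝ≥0∞} (hr : r + r < 1)
    (hclose : ∀ π : Measure X, IsProbabilityMeasure π → κ.Invariant π →
      ∀ A, MeasurableSet A → π A ≤ π₀ A + r ∧ π₀ A ≤ π A + r)
    {μ ν : Measure X} [IsProbabilityMeasure μ] [IsProbabilityMeasure ν]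
    (hμ : κ.Invariant μ) (hν : κ.Invariant ν) : μ = ν := by
  by_contra hne
  have key : ∀ {μ ν : Measure X} [IsProbabilityMeasure μ] [IsProbabilityMeasure ν],
      κ.Invariant μ → κ.Invariant ν → μ ≠ ν → ∃ π : Measure X, IsProbabilityMeasure π ∧
        κ.Invariant π ∧ π ≪ μ - ν := by
    intro μ ν _ _ hμ hν hne
    have hfin : IsFiniteMeasure (μ - ν) := ⟨(Measure.sub_le _).trans_lt (measure_lt_top _ _)⟩
    have h0 : (μ - ν) Set.univ ≠ 0 := fun h => hne <| by
      have hle := le_sub_add_of_finite μ ν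
      rw [Measure.measure_univ_eq_zero.1 h, zero_add] at hle
      exact Measure.eq_of_le_of_isProbabilityMeasure hle
    refine ⟨((μ - ν) Set.univ)⁻¹ • (μ - ν), ⟨?_⟩, ?_, ?_⟩
    · rw [Measure.smul_apply, smul_eq_mul, ENNReal.inv_mul_cancel h0 (measure_ne_top _ _)]
    · rw [Kernel.Invariant, Measure.bind_smul, bind_sub_of_invariant hμ hν]
    · exact Measure.smul_absolutelyContinuous
  obtain ⟨π₁, _, hi₁, hac₁⟩ := key hμ hν hne
  obtain ⟨π₂, _, hi₂, hac₂⟩ := key hν hμ (Ne.symm hne)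
  -- The two truncated differences are mutually singular, so `s` is null for `π₁` and full for `π₂`;
  -- comparing both with `π₀ s` gives 1 ≤ 2r.
  obtain ⟨s, hs, h1, h2⟩ := (Measure.mutually_singular_measure_sub (μ := μ) (ν := ν))
  have h1' : π₁ s = 0 := hac₁ h1
  have h2' : π₂ s = 1 := by
    rw [← prob_compl_eq_zero_iff hs]; exact hac₂ h2
  have a := (hclose π₂ ‹_› hi₂ s hs).1
  have b := (hclose π₁ ‹_› hi₁ s hs).2
  rw [h1', zero_add] at b
  rw [h2'] at a
  exact absurd (a.trans (by gcongr)) (not_le.2 hr)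

end PerturbedMarkov

namespace PerturbedMarkov

/-! ### Weighted norms and integrability -/

section Norms

variable {X : Type*} {V : X → ℝ}

lemma wnorm_le_ofReal_iff (hV : ∀ x, 1 ≤ V x) {β c : ℝ} (hc : 0 ≤ c) {f : X → ℂ} :
    wnorm V β f ≤ ENNReal.ofReal c ↔ ∀ x, ‖f x‖ ≤ c * V x ^ β := by
  rw [wnorm, iSup_le_iff]
  refine forall_congr' fun x => ?_
  have h0 : 0 < V x := zero_lt_one.trans_le (hV x)
  rw [ENNReal.ofReal_le_ofReal_iff hc, Real.rpow_neg h0.le,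
    inv_mul_le_iff₀ (Real.rpow_pos_of_pos h0 _), mul_comm]

lemma enorm_le_of_wnorm_one_le (hV : ∀ x, 1 ≤ V x) {f : X → ℂ} {η : ℝ≥0∞}
    (h : wnorm V 1 f ≤ η) (x : X) : ‖f x‖ₑ ≤ η * ENNReal.ofReal (V x) := by
  have h0 : 0 < V x := zero_lt_one.trans_le (hV x)
  have h1 : ENNReal.ofReal (V x ^ (-1 : ℝ) * ‖f x‖) ≤ η := (iSup_le_iff.1 h) x
  calc ‖f x‖ₑ = ENNReal.ofReal (V x ^ (-1 : ℝ) * ‖f x‖) * ENNReal.ofReal (V x) := by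
        rw [← ENNReal.ofReal_mul' h0.le, Real.rpow_neg_one, ← ofReal_norm]
        congr 1
        field_simp
    _ ≤ _ := by gcongr

lemma enorm_le_of_norm_le_rpow (hV : ∀ x, 1 ≤ V x) {β C : ℝ} (hβ : β ≤ 1) (hC : 0 ≤ C) {z : ℂ}
    {x : X} (h : ‖z‖ ≤ C * V x ^ β) : ‖z‖ₑ ≤ ENNReal.ofReal C * ENNReal.ofReal (V x) := by
  rw [← ENNReal.ofReal_mul hC, ← ofReal_norm]
  refine ENNReal.ofReal_le_ofReal (h.trans ?_)
  gcongr
  simpa using Real.rpow_le_rpow_of_exponent_le (hV x) hβ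

variable [MeasurableSpace X]

lemma mem_unitBall_iff (hV : ∀ x, 1 ≤ V x) {β : ℝ} {f : X → ℂ} :
    f ∈ {f : X → ℂ | f ∈ weightedSpace V β ∧ wnorm V β f ≤ 1} ↔
      Measurable f ∧ ∀ x, ‖f x‖ ≤ V x ^ β := by
  have h := wnorm_le_ofReal_iff hV (β := β) zero_le_one (f := f)
  simp only [ENNReal.ofReal_one, one_mul] at h
  simp only [weightedSpace, Set.mem_ofPred_eq, h, and_assoc]
  constructor
  · rintro ⟨h1, -, h2⟩; exact ⟨h1, h2⟩
  · rintro ⟨h1, h2⟩; exact ⟨h1, (h.2 h2).trans_lt ENNReal.one_lt_top, h2⟩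

lemma wnorm_le_opNorm (hV : ∀ x, 1 ≤ V x) {β β' : ℝ} {T : (X → ℂ) → (X → ℂ)} {f : X → ℂ}
    (hf : Measurable f) (hfV : ∀ x, ‖f x‖ ≤ V x ^ β) : wnorm V β' (T f) ≤ opNorm V β β' T :=
  le_iSup₂ (f := fun (f : X → ℂ)
    (_ : f ∈ {f : X → ℂ | f ∈ weightedSpace V β ∧ wnorm V β f ≤ 1}) => wnorm V β' (T f))
    f ((mem_unitBall_iff hV).2 ⟨hf, hfV⟩)

lemma lintegral_enorm_le (hV : ∀ x, 1 ≤ V x) {β C : ℝ} (hβ : β ≤ 1) (hC : 0 ≤ C) {g : X → ℂ}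
    (hg : ∀ x, ‖g x‖ ≤ C * V x ^ β) (μ : Measure X) :
    ∫⁻ x, ‖g x‖ₑ ∂μ ≤ ENNReal.ofReal C * ∫⁻ x, ENNReal.ofReal (V x) ∂μ := by
  rw [← lintegral_const_mul' _ _ ENNReal.ofReal_ne_top]
  exact lintegral_mono fun x => enorm_le_of_norm_le_rpow hV hβ hC (hg x)

lemma integrable_of_norm_le_rpow (hV : ∀ x, 1 ≤ V x) {β C : ℝ} (hβ : β ≤ 1) (hC : 0 ≤ C)
    {g : X → ℂ} (hgm : Measurable g) (hg : ∀ x, ‖g x‖ ≤ C * V x ^ β) {μ : Measure X}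
    (hμ : ∫⁻ x, ENNReal.ofReal (V x) ∂μ < ∞) : Integrable g μ :=
  ⟨hgm.aestronglyMeasurable, (lintegral_enorm_le hV hβ hC hg μ).trans_lt
    (ENNReal.mul_lt_top ENNReal.ofReal_lt_top hμ)⟩

/-- `V` itself lies in the unit ball of `B_1`, so the operator norm serves as `c`. It is used only
for finiteness of the iterates of `V`; uniform bounds come from the drift. -/
lemma ActsContinuously.exists_lintegral_le (hVm : Measurable V) (hV : ∀ x, 1 ≤ V x)
    {κ : Kernel X X} (h : ActsContinuously V 1 κ) :
    ∃ c : ℝ≥0∞, c ≠ ∞ ∧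
      ∀ x, ∫⁻ y, ENNReal.ofReal (V y) ∂(κ x) ≤ c * ENNReal.ofReal (V x) := by
  have hm : Measurable fun x => (V x : ℂ) := Complex.measurable_ofReal.comp hVm
  have hb : ∀ x, ‖(V x : ℂ)‖ ≤ V x ^ (1 : ℝ) := fun x => by
    simp [abs_of_nonneg (zero_le_one.trans (hV x))]
  refine ⟨_, h.2.ne, fun x => ?_⟩
  refine le_trans (le_of_eq ?_) (enorm_le_of_wnorm_one_le hV (wnorm_le_opNorm hV hm hb) x)
  have hint := h.1 _ ((mem_unitBall_iff hV).2 ⟨hm, hb⟩).1 x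
  have hint' : Integrable V (κ x) := by simpa using hint.re
  rw [act, integral_complex_ofReal, ← ofReal_norm, Complex.norm_real,
    Real.norm_of_nonneg (integral_nonneg fun y => zero_le_one.trans (hV y)),
    ofReal_integral_eq_lintegral_ofReal hint' (ae_of_all _ fun y => zero_le_one.trans (hV y))]

lemma lintegral_pow_le {W : X → ℝ≥0∞} (hW : Measurable W) {κ : Kernel X X} {c : ℝ≥0∞}
    (h : ∀ x, ∫⁻ y, W y ∂(κ x) ≤ c * W x) (n : ℕ) (x : X) :
    ∫⁻ y, W y ∂((κ ^ n) x) ≤ c ^ n * W x := by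
  induction n generalizing x with
  | zero =>
    rw [pow_zero, pow_zero, one_mul]
    change ∫⁻ y, W y ∂(Kernel.id x) ≤ _
    rw [Kernel.id_apply, lintegral_dirac' _ hW]
  | succ n ih =>
    rw [pow_succ', pow_succ]
    change ∫⁻ y, W y ∂((κ ∘ₖ (κ ^ n)) x) ≤ _
    rw [Kernel.lintegral_comp _ _ _ hW]
    calc ∫⁻ y, ∫⁻ z, W z ∂(κ y) ∂((κ ^ n) x) ≤ ∫⁻ y, c * W y ∂((κ ^ n) x) :=
          lintegral_mono h
      _ = c * ∫⁻ y, W y ∂((κ ^ n) x) := lintegral_const_mul _ hW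
      _ ≤ c * (c ^ n * W x) := by gcongr; exact ih x
      _ = _ := by ring

lemma isMarkovKernel_pow (κ : Kernel X X) [IsMarkovKernel κ] (n : ℕ) :
    IsMarkovKernel (κ ^ n) := by
  induction n with
  | zero => rw [pow_zero]; exact inferInstanceAs (IsMarkovKernel Kernel.id)
  | succ n ih => rw [pow_succ]; exact inferInstanceAs (IsMarkovKernel ((κ ^ n) ∘ₖ κ))

lemma integral_bind_eq {μ : Measure X} {κ : Kernel X X} {g : X → ℂ}
    (hg : Integrable g (μ.bind κ)) :
    Integrable (act κ g) μ ∧ ∫ x, g x ∂(μ.bind κ) = ∫ x, act κ g x ∂μ := by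
  rw [Measure.comp_eq_comp_const_apply] at hg ⊢
  exact ⟨by simpa [act, Function.const] using! hg.integral_comp, by simpa [act] using Kernel.integral_comp hg⟩

end Norms

/-! ### Poisson equation and the comparison estimate -/

section Poisson

variable {X : Type*} [MeasurableSpace X] {V : X → ℝ}

/-- Solution of the Poisson equation `g - κ g = f - π₀(f)` for a geometrically ergodic kernel. -/
theorem GeomErgodic.exists_poisson (hVm : Measurable V) (hV : ∀ x, 1 ≤ V x) {κ : Kernel X X}
    [IsMarkovKernel κ] (hact : ActsContinuously V 1 κ) {π₀ : Measure X} {β : ℝ} (hβ : β ≤ 1)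
    (h : GeomErgodic V β κ π₀) :
    ∃ C : ℝ, 0 < C ∧ ∀ f : X → ℂ, Measurable f → (∀ x, ‖f x‖ ≤ V x ^ β) →
      ∃ g : X → ℂ, Measurable g ∧ (∀ x, ‖g x‖ ≤ C * V x ^ β) ∧
        ∀ x, g x - act κ g x = f x - ∫ y, f y ∂π₀ := by
  obtain ⟨c₁, hc₁, hκV⟩ := hact.exists_lintegral_le hVm hV
  have hWm : Measurable fun x => ENNReal.ofReal (V x) := hVm.ennreal_ofReal
  have hpow : ∀ n x, ∫⁻ y, ENNReal.ofReal (V y) ∂((κ ^ n) x) < ∞ := fun n x =>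
    (lintegral_pow_le hWm hκV n x).trans_lt
      (ENNReal.mul_lt_top (ENNReal.pow_lt_top hc₁.lt_top) ENNReal.ofReal_lt_top)
  have hone : ∀ x, ∫⁻ y, ENNReal.ofReal (V y) ∂(κ x) < ∞ := by simpa using hpow 1
  obtain ⟨ρ, hρ0, hρ1, c, hc, hbound⟩ := h
  have hsum : HasSum (fun n : ℕ => c * ρ ^ n) (c * (1 - ρ)⁻¹) :=
    (hasSum_geometric_of_lt_one hρ0.le hρ1).mul_left c
  refine ⟨c * (1 - ρ)⁻¹, mul_pos hc (inv_pos.2 (by linarith)), fun f hf hfV => ?_⟩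
  set b := ∫ y, f y ∂π₀
  -- The solution is the Neumann series `∑ F n`: the kernel sends `F n` to `F (n + 1)`, so g - κg
  -- leaves only `F 0`.
  set F : ℕ → X → ℂ := fun n x => act (κ ^ n) f x - b with hF
  have hFm : ∀ n, Measurable (F n) := fun n =>
    have := isMarkovKernel_pow κ n
    (hf.stronglyMeasurable.integral_kernel).measurable.sub_const b
  have hFb : ∀ n x, ‖F n x‖ ≤ c * ρ ^ n * V x ^ β := fun n => by
    refine (wnorm_le_ofReal_iff hV (by positivity)).1 (le_trans ?_ (hbound n))
    exact wnorm_le_opNorm (T := fun f x => act (κ ^ n) f x - ∫ y, f y ∂π₀) hV hf hfV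
  have hF0 : ∀ x, F 0 x = f x - b := fun x => by
    simp only [hF, act, pow_zero]
    change ∫ y, f y ∂(Kernel.id x) - b = _
    rw [Kernel.id_apply, integral_dirac' _ _ hf.stronglyMeasurable]
  have hFint : ∀ n x, Integrable (F n) (κ x) := fun n x =>
    integrable_of_norm_le_rpow hV hβ (by positivity) (hFm n) (hFb n) (hone x)
  have hFs : ∀ n x, ∫ y, F n y ∂(κ x) = F (n + 1) x := fun n x => by
    have hfi : Integrable f (((κ ^ n) ∘ₖ κ) x) :=
      integrable_of_norm_le_rpow hV hβ zero_le_one hf (by simpa using hfV) (hpow (n + 1) x)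
    have h1 := Kernel.integral_comp hfi
    simp only [hF, act]
    rw [integral_sub hfi.integral_comp (integrable_const b), integral_const, probReal_univ,
      one_smul, pow_succ]
    rw [← h1]
    rfl
  have hsx : ∀ x, HasSum (fun n : ℕ => c * ρ ^ n * V x ^ β) (c * (1 - ρ)⁻¹ * V x ^ β) :=
    fun x => hsum.mul_right _
  have hFsum : ∀ x, Summable fun n => F n x := fun x =>
    Summable.of_norm_bounded (hsx x).summable fun n => hFb n x
  refine ⟨fun x => ∑' n, F n x, ?_, fun x => tsum_of_norm_bounded (hsx x) fun n => hFb n x,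
    fun x => ?_⟩
  · exact measurable_of_tendsto_metrizable
      (fun n => Finset.measurable_sum (Finset.range n) fun i _ => hFm i)
      (tendsto_pi_nhds.2 fun x => by
        simpa only [Finset.sum_apply] using (hFsum x).hasSum.tendsto_sum_nat)
  -- Domination by the geometric series times κV justifies exchanging the kernel with the series.
  · have hnorm : Summable fun n => ∫ y, ‖F n y‖ ∂(κ x) := by
      have hVi : Integrable (fun y => (V y : ℂ)) (κ x) :=
        integrable_of_norm_le_rpow (β := 1) (C := 1) hV le_rfl zero_le_one
          (Complex.measurable_ofReal.comp hVm)
          (fun y => by simp [abs_of_nonneg (zero_le_one.trans (hV y))]) (hone x)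
      have hVi' : Integrable V (κ x) := by simpa using hVi.re
      refine Summable.of_nonneg_of_le (fun n => integral_nonneg fun y => norm_nonneg _)
        (fun n => ?_) (hsum.summable.mul_right (∫ y, V y ∂(κ x)))
      rw [← integral_const_mul]
      refine integral_mono (hFint n x).norm (hVi'.const_mul _) fun y => (hFb n y).trans ?_
      gcongr
      simpa using Real.rpow_le_rpow_of_exponent_le (hV y) hβ
    have h1 := (hasSum_integral_of_summable_integral_norm (fun n => hFint n x) hnorm).tsum_eq
    simp only [hFs] at h1
    simp only [act]
    rw [← h1, (hFsum x).tsum_eq_zero_add, hF0]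
    ring

/-- Comparison of an almost invariant measure of `κ` with the invariant measure of `κ₀`. -/
theorem enorm_integral_sub_le (hV : ∀ x, 1 ≤ V x) {κ κ₀ : Kernel X X}
    {π₀ : Measure X} {β : ℝ} (hβ : β ≤ 1) {C : ℝ} (hC : 0 < C) {f g : X → ℂ}
    (hf : Measurable f) (hfV : ∀ x, ‖f x‖ ≤ V x ^ β) (hg : Measurable g)
    (hgV : ∀ x, ‖g x‖ ≤ C * V x ^ β) (hfg : ∀ x, g x - act κ₀ g x = f x - ∫ y, f y ∂π₀)
    (hVm : Measurable V) {μ a b : Measure X} [IsProbabilityMeasure μ]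
    (hμ : μ.bind κ + a = μ + b)
    (hμV : ∫⁻ x, ENNReal.ofReal (V x) ∂μ < ∞) (haV : ∫⁻ x, ENNReal.ofReal (V x) ∂a < ∞)
    (hbV : ∫⁻ x, ENNReal.ofReal (V x) ∂b < ∞) :
    ‖(∫ x, f x ∂μ) - ∫ x, f x ∂π₀‖ₑ ≤ ENNReal.ofReal C *
      (kernelDist V β 1 κ κ₀ * ∫⁻ x, ENNReal.ofReal (V x) ∂μ +
        (∫⁻ x, ENNReal.ofReal (V x) ∂a + ∫⁻ x, ENNReal.ofReal (V x) ∂b)) := by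
  have hκV : ∫⁻ x, ENNReal.ofReal (V x) ∂(μ.bind κ) < ∞ := by
    have h : ∫⁻ x, ENNReal.ofReal (V x) ∂(μ.bind κ + a) < ∞ := by
      rw [hμ, lintegral_add_measure]; exact ENNReal.add_lt_top.2 ⟨hμV, hbV⟩
    rw [lintegral_add_measure] at h
    exact (ENNReal.add_lt_top.1 h).1
  have hint : ∀ ν : Measure X, ∫⁻ x, ENNReal.ofReal (V x) ∂ν < ∞ → Integrable g ν :=
    fun ν => integrable_of_norm_le_rpow hV hβ hC.le hg hgV
  have hfi : Integrable f μ :=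
    integrable_of_norm_le_rpow hV hβ zero_le_one hf (by simpa using hfV) hμV
  obtain ⟨hκi, hκe⟩ := integral_bind_eq (hint _ hκV)
  have hκ₀ : act κ₀ g = fun x => g x - (f x - ∫ y, f y ∂π₀) := by
    ext x; rw [← hfg x]; ring
  have hκ₀i : Integrable (act κ₀ g) μ := by
    rw [hκ₀]; exact (hint _ hμV).sub (hfi.sub (integrable_const _))
  have hκ₀e : ∫ x, act κ₀ g x ∂μ = ∫ x, g x ∂μ - (∫ x, f x ∂μ - ∫ x, f x ∂π₀) := by
    have h := integral_sub (hint _ hμV) (hfi.sub (integrable_const (∫ y, f y ∂π₀)))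
    simp only [Pi.sub_apply] at h
    rw [hκ₀, h, integral_sub hfi (integrable_const _), integral_const, probReal_univ, one_smul]
  have hsum : ∫ x, g x ∂(μ.bind κ) + ∫ x, g x ∂a = ∫ x, g x ∂μ + ∫ x, g x ∂b := by
    rw [← integral_add_measure (hint _ hκV) (hint _ haV), hμ,
      integral_add_measure (hint _ hμV) (hint _ hbV)]
  -- Integrate the Poisson equation against μ and replace μ(g) using the defect identity. The
  -- defects `a`, `b` vanish for an invariant μ and are the end terms for Cesàro averages.
  have key : (∫ x, f x ∂μ) - ∫ x, f x ∂π₀ =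
      ∫ x, (act κ g x - act κ₀ g x) ∂μ + (∫ x, g x ∂a - ∫ x, g x ∂b) := by
    rw [integral_sub hκi hκ₀i, ← hκe, hκ₀e]
    linear_combination -hsum
  have hdiff : ∀ x, ‖act κ g x - act κ₀ g x‖ₑ ≤
      ENNReal.ofReal C * kernelDist V β 1 κ κ₀ * ENNReal.ofReal (V x) := fun x => by
    -- Rescaling by `C⁻¹` puts g in the unit ball of `B_β`.
    set g' : X → ℂ := fun x => ((C⁻¹ : ℝ) : ℂ) * g x
    have hg' : ∀ x, ‖g' x‖ ≤ V x ^ β := fun x => by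
      simp only [g', norm_mul, Complex.norm_real, Real.norm_of_nonneg (inv_nonneg.2 hC.le)]
      rw [inv_mul_le_iff₀ hC]; exact hgV x
    have h1 := enorm_le_of_wnorm_one_le hV (wnorm_le_opNorm
      (T := fun f x => act κ f x - act κ₀ f x) (β' := 1) hV (hg.const_mul _) hg') x
    have h2 : act κ g x - act κ₀ g x = (C : ℂ) * (act κ g' x - act κ₀ g' x) := by
      simp only [act, g', integral_const_mul]
      rw [← mul_sub, ← mul_assoc, ← Complex.ofReal_mul, mul_inv_cancel₀ hC.ne',
        Complex.ofReal_one, one_mul]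
    have h3 : ‖(C : ℂ)‖ₑ = ENNReal.ofReal C := by
      rw [← ofReal_norm, Complex.norm_real, Real.norm_of_nonneg hC.le]
    rw [h2, enorm_mul, h3, mul_assoc]
    exact mul_le_mul_right h1 _
  rw [key, mul_add, mul_add, ← mul_assoc]
  refine (enorm_add_le _ _).trans (add_le_add ?_ ((enorm_sub_le).trans (add_le_add ?_ ?_)))
  · refine (enorm_integral_le_lintegral_enorm _).trans ?_
    rw [← lintegral_const_mul _ hVm.ennreal_ofReal]
    exact lintegral_mono hdiff
  · exact (enorm_integral_le_lintegral_enorm _).trans (lintegral_enorm_le hV hβ hC.le hgV _)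
  · exact (enorm_integral_le_lintegral_enorm _).trans (lintegral_enorm_le hV hβ hC.le hgV _)

end Poisson

/-! ### Consequences of the drift inequality -/

section Drift

variable {X : Type*} [MeasurableSpace X]

lemma invariant_pow {κ : Kernel X X} {π : Measure X} (h : κ.Invariant π) (n : ℕ) :
    (κ ^ n).Invariant π := by
  induction n with
  | zero =>
    rw [pow_zero, Kernel.Invariant]
    exact Measure.bind_dirac
  | succ n ih => rw [pow_succ]; exact ih.comp h

/-- A drift inequality bounds the integral of the drift function under every invariant
probability measure. -/
theorem lintegral_le_of_invariant_of_drift {κ : Kernel X X} [IsMarkovKernel κ] {π : Measure X}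
    [IsProbabilityMeasure π] (hinv : κ.Invariant π) {W : X → ℝ≥0∞} (hW : Measurable W)
    (hWtop : ∀ x, W x ≠ ∞) {a b L : ℝ≥0∞} (hab : a + b = 1)
    (hdrift : ∀ x, ∫⁻ y, W y ∂(κ x) ≤ a * W x + L) : b * ∫⁻ x, W x ∂π ≤ L := by
  -- π(W) is not yet known to be finite, so the term a·π(W) cannot be cancelled; invariance is
  -- applied to min(W, M) instead, where cancellation is legitimate, and then M → ∞.
  have htrunc : ∀ M : ℕ, b * ∫⁻ x in {x | W x ≤ M}, W x ∂π ≤ L := by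
    intro M
    have hs : MeasurableSet {x | W x ≤ (M : ℝ≥0∞)} := measurableSet_le hW measurable_const
    have h1 : ∫⁻ x, min (W x) M ∂π ≤ ∫⁻ x, min (a * W x + L) M ∂π := by
      have hb : ∫⁻ x, min (W x) M ∂π = ∫⁻ x, ∫⁻ y, min (W y) M ∂(κ x) ∂π := by
        conv_lhs => rw [← hinv.def]
        exact Measure.lintegral_bind κ.aemeasurable (hW.min measurable_const).aemeasurable
      rw [hb]
      refine lintegral_mono fun x => le_min ((lintegral_mono fun y => min_le_left _ _).trans
        (hdrift x)) ((lintegral_mono fun y => min_le_right _ _).trans ?_)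
      simp
    have hfin : ∫⁻ x, min (a * W x + L) M ∂π ≠ ∞ := by
      refine ((lintegral_mono fun x => min_le_right _ _).trans_lt ?_).ne
      simp
    have h2 : ∀ x, b * {x | W x ≤ (M : ℝ≥0∞)}.indicator W x + min (a * W x + L) M ≤
        min (W x) M + L := by
      intro x
      by_cases hx : W x ≤ M
      · rw [Set.indicator_of_mem (by exact hx), min_eq_left hx]
        calc b * W x + min (a * W x + L) M ≤ b * W x + (a * W x + L) := by
              gcongr; exact min_le_left _ _
          _ = (a + b) * W x + L := by ring
          _ = W x + L := by rw [hab, one_mul]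
      · rw [Set.indicator_of_notMem (by exact hx), min_eq_right (not_le.1 hx).le, mul_zero,
          zero_add]
        exact (min_le_right _ _).trans le_self_add
    have h3 := lintegral_mono (μ := π) h2
    rw [lintegral_add_left ((hW.indicator hs).const_mul b),
      lintegral_add_left (hW.min measurable_const), lintegral_const_mul _ (hW.indicator hs),
      lintegral_indicator hs, lintegral_const, measure_univ, mul_one] at h3
    refine (ENNReal.add_le_add_iff_right hfin).1 (h3.trans ?_)
    rw [add_comm]
    gcongr
  have hmono : Monotone fun M : ℕ => {x | W x ≤ (M : ℝ≥0∞)} := fun m n hmn x hx =>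
    le_trans (show W x ≤ m from hx) (by exact_mod_cast hmn)
  have hU : ⋃ M : ℕ, {x | W x ≤ (M : ℝ≥0∞)} = Set.univ := Set.eq_univ_of_forall fun x => by
    obtain ⟨M, hM⟩ := ENNReal.exists_nat_gt (hWtop x)
    exact Set.mem_iUnion.2 ⟨M, hM.le⟩
  rw [← setLIntegral_univ, ← hU, setLIntegral_iUnion_of_directed _ hmono.directed_le,
    ENNReal.mul_iSup]
  exact iSup_le htrunc

/-- Growth of the partial sums and terms of a sequence satisfying a drift inequality. -/
lemma sum_le_of_drift {u : ℕ → ℝ≥0∞} (hu : ∀ k, u k ≠ ∞) {N : ℕ} (hN : 1 ≤ N)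
    {a b L : ℝ≥0∞} (hab : a + b = 1) (h : ∀ k, u (k + N) ≤ a * u k + L) (n : ℕ) :
    b * ∑ k ∈ Finset.range n, u k ≤ ∑ k ∈ Finset.range N, u k + n * L ∧
      b * u n ≤ b * ∑ k ∈ Finset.range N, u k + L := by
  have ha : a ≤ 1 := hab ▸ le_self_add
  constructor
  · set S := ∑ k ∈ Finset.range n, u k
    have hS : a * S ≠ ∞ := ENNReal.mul_ne_top (ne_top_of_le_ne_top ENNReal.one_ne_top ha)
      (ENNReal.sum_ne_top.2 fun k _ => hu k)
    -- Shifting the sum by `N` costs only the first `N` terms; the finite quantity `a * S` then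
    -- cancels.
    refine (ENNReal.add_le_add_iff_left hS).1 ?_
    calc a * S + b * S = S := by rw [← add_mul, hab, one_mul]
      _ ≤ ∑ k ∈ Finset.range (N + n), u k :=
        Finset.sum_le_sum_of_subset (Finset.range_mono (by omega))
      _ = ∑ k ∈ Finset.range N, u k + ∑ k ∈ Finset.range n, u (k + N) := by
        rw [Finset.sum_range_add]
        simp only [add_comm]
      _ ≤ ∑ k ∈ Finset.range N, u k + ∑ k ∈ Finset.range n, (a * u k + L) := by
        gcongr; exact h _
      _ = a * S + (∑ k ∈ Finset.range N, u k + n * L) := by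
        rw [Finset.sum_add_distrib, ← Finset.mul_sum, Finset.sum_const, Finset.card_range,
          nsmul_eq_mul]
        ring
  · set S := ∑ k ∈ Finset.range N, u k
    induction n using Nat.strong_induction_on with
    | _ n ih =>
      by_cases hn : n < N
      · refine le_trans ?_ le_self_add
        gcongr
        exact Finset.single_le_sum (f := u) (fun _ _ => zero_le) (Finset.mem_range.2 hn)
      · obtain ⟨k, rfl⟩ := Nat.exists_eq_add_of_le' (not_lt.1 hn)
        calc b * u (k + N) ≤ b * (a * u k + L) := by gcongr; exact h k
          _ = a * (b * u k) + b * L := by ring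
          _ ≤ a * (b * S + L) + b * L := by gcongr; exact ih k (by omega)
          _ = a * (b * S) + (a + b) * L := by ring
          _ ≤ 1 * (b * S) + 1 * L := by rw [hab]; gcongr
          _ = b * S + L := by ring

end Drift

/-- Turns the complex-valued estimate, applied to indicators, into the two-sided set inequalities
needed for existence and uniqueness. -/
lemma measure_le_of_enorm_integral_indicator_le {X : Type*} [MeasurableSpace X] {μ ν : Measure X}
    [IsFiniteMeasure μ] [IsFiniteMeasure ν] {A : Set X} (hA : MeasurableSet A) {t : ℝ≥0∞}
    (h : ‖(∫ x, A.indicator (1 : X → ℂ) x ∂μ) - ∫ x, A.indicator (1 : X → ℂ) x ∂ν‖ₑ ≤ t) :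
    μ A ≤ ν A + t ∧ ν A ≤ μ A + t := by
  have hi : ∀ ρ : Measure X, ∫ x, A.indicator (1 : X → ℂ) x ∂ρ = (ρ.real A : ℂ) := fun ρ => by
    rw [integral_indicator hA]
    simp
  rw [hi, hi, ← Complex.ofReal_sub, ← ofReal_norm, Complex.norm_real, Real.norm_eq_abs] at h
  have key : ∀ x y : ℝ, 0 ≤ y → ENNReal.ofReal |x - y| ≤ t →
      ENNReal.ofReal x ≤ ENNReal.ofReal y + t := fun x y hy hxy => by
    refine le_trans ?_ (add_le_add_right hxy _)
    rw [← ENNReal.ofReal_add hy (abs_nonneg _)]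
    exact ENNReal.ofReal_le_ofReal (by linarith [le_abs_self (x - y)])
  rw [← ofReal_measureReal (μ := μ), ← ofReal_measureReal (μ := ν)]
  exact ⟨key _ _ measureReal_nonneg h, key _ _ measureReal_nonneg (abs_sub_comm (μ.real A) _ ▸ h)⟩

end PerturbedMarkov

namespace PerturbedMarkov

/-! ### Cesàro averages -/

section Cesaro

variable {X : Type*} [MeasurableSpace X]

/-- The averages of the first `n + 1` transition probabilities started at `x`. -/
noncomputable def cesaroMeasure (κ : Kernel X X) (x : X) (n : ℕ) : Measure X :=
  ((n + 1 : ℕ) : ℝ≥0∞)⁻¹ • ∑ k ∈ Finset.range (n + 1), (κ ^ k) x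

lemma cesaroMeasure_isProbabilityMeasure (κ : Kernel X X) [IsMarkovKernel κ] (x : X) (n : ℕ) :
    IsProbabilityMeasure (cesaroMeasure κ x n) := by
  refine ⟨?_⟩
  have h : ∀ k, (κ ^ k) x Set.univ = 1 := fun k =>
    have := isMarkovKernel_pow κ k
    measure_univ
  rw [cesaroMeasure, Measure.smul_apply, Measure.finsetSum_apply]
  simp only [h, Finset.sum_const, Finset.card_range, smul_eq_mul, nsmul_eq_mul, mul_one]
  exact ENNReal.inv_mul_cancel (by simp) (ENNReal.natCast_ne_top _)

lemma lintegral_cesaroMeasure (κ : Kernel X X) (x : X) (n : ℕ) (f : X → ℝ≥0∞) :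
    ∫⁻ y, f y ∂(cesaroMeasure κ x n) =
      ((n + 1 : ℕ) : ℝ≥0∞)⁻¹ * ∑ k ∈ Finset.range (n + 1), ∫⁻ y, f y ∂((κ ^ k) x) := by
  rw [cesaroMeasure, lintegral_smul_measure, lintegral_finsetSum_measure, smul_eq_mul]

/-- The sum telescopes, leaving only its end terms. The subtraction-free form is the defect identity
required by `enorm_integral_sub_le`. -/
lemma cesaroMeasure_bind (κ : Kernel X X) (x : X) (n : ℕ) :
    (cesaroMeasure κ x n).bind κ + ((n + 1 : ℕ) : ℝ≥0∞)⁻¹ • (κ ^ 0) x =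
      cesaroMeasure κ x n + ((n + 1 : ℕ) : ℝ≥0∞)⁻¹ • (κ ^ (n + 1)) x := by
  have h : ∀ m : ℕ, (∑ k ∈ Finset.range m, (κ ^ k) x).bind κ + (κ ^ 0) x =
      ∑ k ∈ Finset.range m, (κ ^ k) x + (κ ^ m) x := by
    intro m
    induction m with
    | zero => simp
    | succ m ih =>
      have h1 : ((κ ^ m) x).bind κ = (κ ^ (m + 1)) x := by
        rw [pow_succ']; exact (Kernel.comp_apply κ (κ ^ m) x).symm
      rw [Finset.sum_range_succ, Measure.comp_add, h1, add_right_comm, ih]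
  rw [cesaroMeasure, Measure.bind_smul, ← smul_add, ← smul_add, h]

end Cesaro

/-! ### Existence, uniqueness and distance for one perturbed kernel -/

section Perturbation

variable {X : Type*} [MeasurableSpace X] {V : X → ℝ}

/-- A small perturbation, satisfying a drift condition, of a kernel whose Poisson equation is
solvable has a unique invariant probability measure. -/
theorem exists_isUniqueInvariantProb (hVm : Measurable V) (hV : ∀ x, 1 ≤ V x)
    {κ κ₀ : Kernel X X} [IsMarkovKernel κ] (hact : ActsContinuously V 1 κ)
    {π₀ : Measure X} [IsProbabilityMeasure π₀] {β C : ℝ} (hβ0 : 0 ≤ β) (hβ : β ≤ 1) (hC : 0 < C)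
    (hpoisson : ∀ f : X → ℂ, Measurable f → (∀ x, ‖f x‖ ≤ V x ^ β) →
      ∃ g : X → ℂ, Measurable g ∧ (∀ x, ‖g x‖ ≤ C * V x ^ β) ∧
        ∀ x, g x - act κ₀ g x = f x - ∫ y, f y ∂π₀)
    {N : ℕ} (hN : 1 ≤ N) {a b L : ℝ≥0∞} (hab : a + b = 1) (hb : b ≠ 0) (hL : L ≠ ∞)
    (hdrift : ∀ x, ∫⁻ y, ENNReal.ofReal (V y) ∂((κ ^ N) x) ≤ a * ENNReal.ofReal (V x) + L)
    (hη : kernelDist V β 1 κ κ₀ ≠ ∞)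
    (hr : ENNReal.ofReal C * (kernelDist V β 1 κ κ₀ * (L / b)) +
      ENNReal.ofReal C * (kernelDist V β 1 κ κ₀ * (L / b)) < 1) :
    ∃ π : Measure X, IsUniqueInvariantProb κ π ∧
      ∫⁻ x, ENNReal.ofReal (V x) ∂π ≤ L / b ∧
      measureDist V β π π₀ ≤
        ENNReal.ofReal C * (kernelDist V β 1 κ κ₀ * (L / b)) := by
  set η := kernelDist V β 1 κ κ₀
  have hbtop : b ≠ ∞ := ne_top_of_le_ne_top ENNReal.one_ne_top (hab ▸ le_add_self)
  have hLb : L / b ≠ ∞ := ENNReal.div_ne_top hL hb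
  have hWm : Measurable fun x => ENNReal.ofReal (V x) := hVm.ennreal_ofReal
  -- Indicators lie in the unit ball of `B_β` because V^β ≥ 1, so the Poisson estimate controls
  -- measures of sets.
  have hind : ∀ A : Set X, MeasurableSet A → Measurable (A.indicator (1 : X → ℂ)) ∧
      ∀ x, ‖A.indicator (1 : X → ℂ) x‖ ≤ V x ^ β := fun A hA =>
    ⟨measurable_one.indicator hA, fun x => by
      have h1 : 1 ≤ V x ^ β := Real.one_le_rpow (hV x) hβ0
      by_cases hx : x ∈ A
      · simpa [hx] using h1
      · simpa [hx] using zero_le_one.trans h1⟩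
  -- integrals under invariant measures
  have hinvV : ∀ π : Measure X, IsProbabilityMeasure π → κ.Invariant π →
      ∫⁻ x, ENNReal.ofReal (V x) ∂π ≤ L / b := fun π _ hπ => by
    have := isMarkovKernel_pow κ N
    rw [ENNReal.le_div_iff_mul_le (Or.inl hb) (Or.inl hbtop), mul_comm]
    exact lintegral_le_of_invariant_of_drift (invariant_pow hπ N) hWm
      (fun x => ENNReal.ofReal_ne_top) hab hdrift
  have hinvd : ∀ π : Measure X, IsProbabilityMeasure π → κ.Invariant π →
      ∀ f : X → ℂ, Measurable f → (∀ x, ‖f x‖ ≤ V x ^ β) →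
      ‖(∫ x, f x ∂π) - ∫ x, f x ∂π₀‖ₑ ≤ ENNReal.ofReal C * (η * (L / b)) :=
    fun π _ hπ f hf hfV => by
      obtain ⟨g, hg, hgV, hfg⟩ := hpoisson f hf hfV
      have h := enorm_integral_sub_le (a := 0) (b := 0) hV hβ hC hf hfV hg hgV hfg hVm
        (by rw [hπ.def]) ((hinvV π ‹_› hπ).trans_lt hLb.lt_top) (by simp) (by simp)
      simp only [lintegral_zero_measure, add_zero] at h
      refine h.trans ?_
      gcongr
      exact hinvV π ‹_› hπ
  -- existence
  obtain ⟨π, hπ, hinv⟩ : ∃ π : Measure X, IsProbabilityMeasure π ∧ κ.Invariant π := by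
    obtain ⟨x⟩ : Nonempty X := π₀.nonempty_of_neZero
    obtain ⟨c, hc, hκV⟩ := hact.exists_lintegral_le hVm hV
    set u : ℕ → ℝ≥0∞ := fun k => ∫⁻ y, ENNReal.ofReal (V y) ∂((κ ^ k) x) with hu_def
    have hu : ∀ k, u k ≠ ∞ := fun k => ((lintegral_pow_le hWm hκV k x).trans_lt
      (ENNReal.mul_lt_top (ENNReal.pow_lt_top hc.lt_top) ENNReal.ofReal_lt_top)).ne
    have hurec : ∀ k, u (k + N) ≤ a * u k + L := fun k => by
      have := isMarkovKernel_pow κ k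
      simp only [hu_def]
      rw [add_comm, pow_add]
      change ∫⁻ y, ENNReal.ofReal (V y) ∂(((κ ^ N) ∘ₖ (κ ^ k)) x) ≤ _
      rw [Kernel.lintegral_comp _ _ _ hWm]
      refine (lintegral_mono hdrift).trans (le_of_eq ?_)
      rw [lintegral_add_right _ measurable_const, lintegral_const_mul _ hWm, lintegral_const,
        measure_univ, mul_one]
    set S := ∑ k ∈ Finset.range N, u k
    have hS : S ≠ ∞ := ENNReal.sum_ne_top.2 fun k _ => hu k
    have hdrift' := fun n => sum_le_of_drift hu hN hab hurec n
    set q : ℕ → ℝ≥0∞ := fun n => ((n + 1 : ℕ) : ℝ≥0∞)⁻¹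
    have hq : ∀ n, q n ≠ ∞ := fun n => ENNReal.inv_ne_top.2 (by simp)
    have hqlim : Tendsto q atTop (𝓝 0) :=
      (tendsto_add_atTop_iff_nat 1).2 ENNReal.tendsto_inv_nat_nhds_zero
    have hmV : ∀ n, ∫⁻ y, ENNReal.ofReal (V y) ∂(cesaroMeasure κ x n) ≤ L / b + q n * (S / b) := by
      intro n
      rw [lintegral_cesaroMeasure]
      have h1 : ∑ k ∈ Finset.range (n + 1), u k ≤ (S + (n + 1 : ℕ) * L) / b := by
        rw [ENNReal.le_div_iff_mul_le (Or.inl hb) (Or.inl hbtop), mul_comm]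
        exact (hdrift' (n + 1)).1
      refine (mul_le_mul_right h1 (q n)).trans (le_of_eq ?_)
      have h2 : q n * ((n + 1 : ℕ) : ℝ≥0∞) = 1 :=
        ENNReal.inv_mul_cancel (by simp) (ENNReal.natCast_ne_top _)
      rw [ENNReal.add_div, mul_add, add_comm, mul_div_assoc, ← mul_assoc, h2, one_mul]
    have huV : ∀ n, u n ≤ S + L / b := fun n => by
      rw [← ENNReal.mul_le_mul_iff_right hb hbtop, mul_add, ENNReal.mul_div_cancel hb hbtop]
      exact (hdrift' n).2
    -- `D` collects everything multiplied by `q n` in the Poisson estimate for the averages; the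
    -- extra 1 in `D + 1` below absorbs the almost-invariance error `q n`.
    set D : ℝ≥0∞ := ENNReal.ofReal C * (η * (S / b) + (u 0 + (S + L / b)))
    have hD : D ≠ ∞ := by
      have := ENNReal.div_ne_top hS hb
      have := hu 0
      finiteness
    have hprob := cesaroMeasure_isProbabilityMeasure κ x
    refine exists_invariant_of_asymptotically_invariant (m := cesaroMeasure κ x)
      (e := fun n => q n * (D + 1)) (π₀ := π₀) (r := ENNReal.ofReal C * (η * (L / b)))
      ?_ ?_ (lt_of_le_of_lt le_self_add hr) ?_
    · simpa using ENNReal.Tendsto.mul_const hqlim (b := D + 1) (Or.inr (by finiteness))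
    · intro n A hA
      have := isMarkovKernel_pow κ (n + 1)
      have h1 := congrArg (fun μ : Measure X => μ A) (cesaroMeasure_bind κ x n)
      simp only [Measure.add_apply, Measure.smul_apply, smul_eq_mul] at h1
      calc (cesaroMeasure κ x n).bind κ A ≤ cesaroMeasure κ x n A + q n * (κ ^ (n + 1)) x A :=
            le_self_add.trans h1.le
        _ ≤ cesaroMeasure κ x n A + q n * (D + 1) := by
          gcongr
          exact prob_le_one.trans le_add_self
    · intro n A hA
      obtain ⟨g, hg, hgV, hfg⟩ := hpoisson _ (hind A hA).1 (hind A hA).2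
      have hsV : ∀ k, ∫⁻ y, ENNReal.ofReal (V y) ∂(q n • (κ ^ k) x) = q n * u k := fun k => by
        rw [lintegral_smul_measure, smul_eq_mul]
      have hsV' : ∀ k, ∫⁻ y, ENNReal.ofReal (V y) ∂(q n • (κ ^ k) x) < ∞ := fun k => by
        rw [hsV]; exact ENNReal.mul_lt_top (hq n).lt_top (hu k).lt_top
      have hmtop : ∫⁻ y, ENNReal.ofReal (V y) ∂(cesaroMeasure κ x n) < ∞ := by
        refine (hmV n).trans_lt ?_
        have := ENNReal.div_ne_top hS hb
        have := hq n
        finiteness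
      have h := enorm_integral_sub_le hV hβ hC (hind A hA).1 (hind A hA).2 hg hgV hfg hVm
        (cesaroMeasure_bind κ x n) hmtop (hsV' 0) (hsV' (n + 1))
      refine (measure_le_of_enorm_integral_indicator_le hA h).2.trans ?_
      rw [hsV, hsV]
      gcongr
      calc ENNReal.ofReal C * (η * ∫⁻ y, ENNReal.ofReal (V y) ∂(cesaroMeasure κ x n) +
              (q n * u 0 + q n * u (n + 1)))
          ≤ ENNReal.ofReal C * (η * (L / b + q n * (S / b)) +
              (q n * u 0 + q n * (S + L / b))) := by
            gcongr
            · exact hmV n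
            · exact huV _
        _ = ENNReal.ofReal C * (η * (L / b)) + q n * D := by ring
        _ ≤ ENNReal.ofReal C * (η * (L / b)) + q n * (D + 1) := by
            gcongr
            exact le_self_add
  refine ⟨π, ⟨hπ, hinv, fun ν hν hνinv => ?_⟩, hinvV π hπ hinv, ?_⟩
  · exact invariant_unique_of_close (π₀ := π₀) hr (fun ρ hρ hρinv A hA =>
      measure_le_of_enorm_integral_indicator_le hA
        (hinvd ρ hρ hρinv _ (hind A hA).1 (hind A hA).2)) hνinv hinv
  · refine iSup₂_le fun f hf => ?_
    obtain ⟨hfm, hfV⟩ := (mem_unitBall_iff hV).1 hf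
    exact hinvd π hπ hinv f hfm hfV

end Perturbation

end PerturbedMarkov

/-! ### The theorem -/

open PerturbedMarkov in
theorem corollary1 {X : Type*} [MeasurableSpace X]
    (V : X → ℝ) (hVmeas : Measurable V) (hV : ∀ x, 1 ≤ V x)
    (ε₀ : ℝ) (hε₀ : 0 < ε₀)
    (P : ℝ → Kernel X X)
    (hMarkov : ∀ ε : ℝ, |ε| < ε₀ → IsMarkovKernel (P ε))
    (hact : ∀ ε : ℝ, |ε| < ε₀ → ActsContinuously V 1 (P ε))
    (π₀ : Measure X) (hπ₀ : IsUniqueInvariantProb (P 0) π₀)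
    (hπ₀V : ∫⁻ x, ENNReal.ofReal (V x) ∂π₀ < ∞)
    (hV1 : GeomErgodic V 1 (P 0) π₀)
    (hD : DriftCondition V ε₀ P)
    (β : ℝ) (hβ0 : 0 < β) (hβ1 : β ≤ 1)
    (hVβ : GeomErgodic V β (P 0) π₀)
    (hcont : Tendsto (fun ε : ℝ => kernelDist V β 1 (P ε) (P 0)) (𝓝 0) (𝓝 0)) :
    ∃ ε₁ : ℝ, 0 < ε₁ ∧ ε₁ ≤ ε₀ ∧ ∃ C : ℝ, 0 < C ∧
      ∀ ε : ℝ, |ε| < ε₁ → ∃ π : Measure X,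
        IsUniqueInvariantProb (P ε) π ∧
        ∫⁻ x, ENNReal.ofReal (V x) ∂π < ∞ ∧
        measureDist V β π π₀ ≤ ENNReal.ofReal C * kernelDist V β 1 (P ε) (P 0) := by
  have h0 : |(0 : ℝ)| < ε₀ := by simpa using hε₀
  have := hMarkov 0 h0
  have := hπ₀.1
  obtain ⟨C, hC, hpoisson⟩ := hVβ.exists_poisson hVmeas hV (hact 0 h0) hβ1
  obtain ⟨N, hN, L, hL, δ, hδ0, hδ1, hdrift⟩ := hD
  have hδN : δ ^ N < 1 := pow_lt_one₀ hδ0.le hδ1 (by omega)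
  have hb : 0 < 1 - δ ^ N := by linarith
  have hB : ENNReal.ofReal L / ENNReal.ofReal (1 - δ ^ N) = ENNReal.ofReal (L / (1 - δ ^ N)) :=
    (ENNReal.ofReal_div_of_pos hb).symm
  -- The doubled term is r + r; making it less than 1 is what fixes the radius.
  have hlim : Tendsto (fun ε : ℝ => ENNReal.ofReal C *
      (kernelDist V β 1 (P ε) (P 0) * ENNReal.ofReal (L / (1 - δ ^ N))) + ENNReal.ofReal C *
      (kernelDist V β 1 (P ε) (P 0) * ENNReal.ofReal (L / (1 - δ ^ N)))) (𝓝 0) (𝓝 0) := by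
    have h1 := ENNReal.Tendsto.const_mul (a := ENNReal.ofReal C)
      (ENNReal.Tendsto.mul_const (b := ENNReal.ofReal (L / (1 - δ ^ N))) hcont
        (Or.inr ENNReal.ofReal_ne_top)) (Or.inr ENNReal.ofReal_ne_top)
    simpa using h1.add h1
  obtain ⟨ε₂, hε₂, hball⟩ := Metric.eventually_nhds_iff.1
    ((hlim.eventually_lt_const zero_lt_one).and (hcont.eventually_lt_const ENNReal.zero_lt_top))
  refine ⟨min ε₂ ε₀, lt_min hε₂ hε₀, min_le_right _ _, C * (L / (1 - δ ^ N)),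
    mul_pos hC (div_pos hL hb), fun ε hε => ?_⟩
  have hε' : |ε| < ε₀ := hε.trans_le (min_le_right _ _)
  obtain ⟨hr, hη⟩ := hball (y := ε) (by simpa using hε.trans_le (min_le_left _ _))
  have := hMarkov ε hε'
  obtain ⟨π, hπ, hπV, hdist⟩ := exists_isUniqueInvariantProb hVmeas hV (hact ε hε') hβ0.le hβ1 hC
    hpoisson hN (a := ENNReal.ofReal (δ ^ N)) (b := ENNReal.ofReal (1 - δ ^ N))
    (L := ENNReal.ofReal L)
    (by rw [← ENNReal.ofReal_add (by positivity) hb.le]; simp)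
    (ENNReal.ofReal_pos.2 hb).ne' ENNReal.ofReal_ne_top
    (fun x => by
      have hx : 0 ≤ V x := zero_le_one.trans (hV x)
      rw [← ENNReal.ofReal_mul (by positivity), ← ENNReal.ofReal_add (by positivity) hL.le]
      exact hdrift ε hε' x)
    hη.ne (by rw [hB]; exact hr)
  refine ⟨π, hπ, hπV.trans_lt (by rw [hB]; exact ENNReal.ofReal_lt_top), hdist.trans_eq ?_⟩
  rw [hB, ENNReal.ofReal_mul hC.le]
  ring
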